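/- Let $p\le n$, let $\mathcal F\subseteq\mathbb R^{n\times p}$ be a linear subspace with the inner product $\langle X,Y\rangle=\operatorname{tr}(X^\top Y)$ and the Frobenius norm $\|\cdot\|$, and let $\mathcal G=\operatorname{span}\{X_1^\top X_2: X_1,X_2\in\mathcal F\}$. Assume that $XT\in\mathcal F$ for all $X\in\mathcal F$, $T\in\mathcal G$. Let $\phi:\mathcal F\to\mathcal F$ be linear, one-to-one and self-adjoint, and let $\psi:\mathcal G\to\mathcal G$ be linear with $\phi(XT)=\phi(X)\psi(T)$ and $\psi(\phi(X)^\top X)=X^\top\phi(X)$ for all $X\in\mathcal F$, $T\in\mathcal G$. Put $$\mathcal M=\{X\in\mathcal F: X^\top\phi(X)=I_p\},\qquad \Phi(T)=T^\top+\psi(T),\qquad \mathcal S_1=\{\Phi(T):T\in\mathcal G\},$$ where $\mathcal M$ carries the Riemannian metric inherited from $\mathcal F$. Let $T_X\mathcal M$ be the tangent space (the velocities at $X$ of smooth curves in $\mathcal M$) and $\mathcal P_{T_X\mathcal M}$ the orthogonal projection of $\mathcal F$ onto it. Let $f:\mathcal F\to\mathbb R$ be differentiable, with gradient $\nabla f$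 in $\mathcal F$, and let $X\in\mathcal M$. 1. For every $D\in\mathcal F$ the least-squares problem $\min_{S\in\mathcal S_1}\|\phi(X)S-D\|^2$ has exactly one solution, denoted by $\Theta_X(D)$, and the Riemannian gradient at $X$ of the restriction of $f$ to $\mathcal M$ is $$\operatorname{grad}f(X)=\nabla f(X)-\phi(X)\,\Theta_X(\nabla f(X)).$$ 2. $\mathcal M$ has a Riemannian (Levi-Civita) connection $\nabla^{\mathcal M}$. If $\nabla f$ is differentiable at $X$, with derivative $\nabla^2f(X)$, then the vector field $\operatorname{grad}f$ on $\mathcal M$ is differentiable at $X$, and the Riemannian Hessian $\operatorname{hess}f(X)[Z]=\nabla^{\mathcal M}_Z\operatorname{grad}f$ satisfies, for all $Z\in T_X\mathcal M$, $$\operatorname{hess}f(X)[Z]=\mathcal P_{T_X\mathcal M}\bigl(\nabla^2f(X)[Z]-\phi(Z)\,\Theta_X(\nabla f(X))\bigr).$$ -/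

import Mathlib

open Set Filter Topology
open scoped Matrix ContDiff Gradient RealInnerProductSpace

noncomputable section

/-! ### Riemannian geometry of a subset of a Euclidean space

`E` is a finite-dimensional real inner product space and `M` a subset of `E`, meant to be an embedded
submanifold with the metric inherited from `E`. Functions and vector fields on `M` are given by
functions on `E`, of which only the values on `M` matter. They are differentiable at `x ∈ M` as
functions on `M` when they are differentiable at `x` within `M`. The derivative within `M` is
determined on the tangent space at `x`, and it is only ever applied to tangent vectors. -/

namespace EmbeddedRiemannian

variable {E : Type*} [NormedAddCommGroup E] [InnerProductSpace ℝ E] [FiniteDimensional ℝ E]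

/-- The velocities at `x` of the smooth curves through `x` that lie in `M`. -/
def velocities (M : Set E) (x : E) : Set E :=
  {v | ∃ (ε : ℝ) (γ : ℝ → E), 0 < ε ∧ ContDiffOn ℝ ∞ γ (Ioo (-ε) ε) ∧
    (∀ t ∈ Ioo (-ε) ε, γ t ∈ M) ∧ γ 0 = x ∧ HasDerivAt γ v 0}

/-- The tangent space of `M` at `x`. (For a submanifold the velocities already form a linear
subspace, and the span adds nothing.) -/
def tangentSpace (M : Set E) (x : E) : Submodule ℝ E :=
  Submodule.span ℝ (velocities M x)

/-- The orthogonal projection of `E` onto the tangent space of `M` at `x`. -/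
def tangentProj (M : Set E) (x : E) : E →L[ℝ] E :=
  (tangentSpace M x).starProjection

/-- The Riemannian gradient at `x` of the restriction of `f` to `M`: the tangent vector that
represents the differential of `f` on the tangent space. -/
def riemannianGradient (M : Set E) (f : E → ℝ) (x : E) : tangentSpace M x :=
  (InnerProductSpace.toDual ℝ (tangentSpace M x)).symm
    ((fderivWithin ℝ f M x).comp (tangentSpace M x).subtypeL)

/-- The Riemannian gradient as a vector field on `M` with values in `E`. -/
def gradientField (M : Set E) (f : E → ℝ) (x : E) : E :=
  riemannianGradient M f x

/-- `V` is a vector field on `M`. -/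
def IsTangentField (M : Set E) (V : E → E) : Prop :=
  ∀ x ∈ M, V x ∈ tangentSpace M x

/-- The type of the covariant derivatives: `D V x z` stands for `∇_z V` at `x`. -/
abbrev CovDeriv (M : Set E) : Type _ :=
  (E → E) → (x : E) → tangentSpace M x →ₗ[ℝ] tangentSpace M x

/-- `D` is the Riemannian (Levi-Civita) connection of `M`: an affine connection that is compatible
with the metric and free of torsion. As in Mathlib's `IsCovariantDerivativeOn`, `∇_z V` at `x`
depends only on the vector `z` by construction, and the laws are imposed on the vector fields
that are differentiable at the point in question. -/
structure IsRiemannianConnection (M : Set E) (D : CovDeriv M) : Prop where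
  congr : ∀ V W : E → E, IsTangentField M V → IsTangentField M W → EqOn V W M →
    ∀ x ∈ M, D V x = D W x
  add : ∀ V W : E → E, IsTangentField M V → IsTangentField M W → ∀ x ∈ M,
    DifferentiableWithinAt ℝ V M x → DifferentiableWithinAt ℝ W M x →
    D (fun y => V y + W y) x = D V x + D W x
  leibniz : ∀ (g : E → ℝ) (V : E → E), IsTangentField M V → ∀ x ∈ M,
    DifferentiableWithinAt ℝ g M x → DifferentiableWithinAt ℝ V M x →
    ∀ z : tangentSpace M x, (D (fun y => g y • V y) x z : E) =
      g x • (D V x z : E) + fderivWithin ℝ g M x z • V x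
  metric : ∀ V W : E → E, IsTangentField M V → IsTangentField M W → ∀ x ∈ M,
    DifferentiableWithinAt ℝ V M x → DifferentiableWithinAt ℝ W M x →
    ∀ z : tangentSpace M x, fderivWithin ℝ (fun y => ⟪V y, W y⟫) M x z =
      ⟪(D V x z : E), W x⟫ + ⟪V x, (D W x z : E)⟫
  torsion_free : ∀ (U V : E → E) (hU : IsTangentField M U) (hV : IsTangentField M V),
    ∀ (x : E) (hx : x ∈ M),
    DifferentiableWithinAt ℝ U M x → DifferentiableWithinAt ℝ V M x →
    (D V x ⟨U x, hU x hx⟩ : E) - (D U x ⟨V x, hV x hx⟩ : E) =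
      VectorField.lieBracketWithin ℝ U V M x

/-- The Riemannian connection of `M`. -/
def riemannianConnection (M : Set E) : CovDeriv M :=
  Classical.epsilon (IsRiemannianConnection M)

/-- The Riemannian Hessian of `f` at `x`: the covariant derivative `z ↦ ∇_z grad f`. -/
def riemannianHessian (M : Set E) (f : E → ℝ) (x : E) :
    tangentSpace M x →ₗ[ℝ] tangentSpace M x :=
  riemannianConnection M (gradientField M f) x

end EmbeddedRiemannian

/-! ### The feasible region of the generalized orthogonal optimization problem -/

namespace GOOCP

/-- Real matrices carry the Frobenius norm. -/
instance matrixNormed {m k : ℕ} : NormedAddCommGroup (Matrix (Fin m) (Fin k) ℝ) :=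
  Matrix.frobeniusNormedAddCommGroup

/-- The inner product `⟨X, Y⟩ = tr (Xᵀ Y)` of real matrices; its norm is the Frobenius norm. -/
instance matrixInner {m k : ℕ} : InnerProductSpace ℝ (Matrix (Fin m) (Fin k) ℝ) where
  toNormedSpace := Matrix.frobeniusNormedSpace
  inner X Y := (Xᵀ * Y).trace
  norm_sq_eq_re_inner X := by
    have h0 : (0 : ℝ) ≤ ∑ i, ∑ j, ‖X i j‖ ^ (2 : ℝ) := by positivity
    have h : ‖X‖ ^ 2 = ∑ i, ∑ j, X i j * X i j := by
      rw [Matrix.frobenius_norm_def, ← Real.sqrt_eq_rpow, Real.sq_sqrt h0]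
      simp [← pow_two]
    rw [h, Finset.sum_comm]
    simp [Matrix.trace, Matrix.mul_apply]
  conj_inner_symm X Y := by
    simpa using (Matrix.trace_transpose (Yᵀ * X)).symm
  add_left X Y Z := by simp [Matrix.add_mul]
  smul_left X Y r := by simp

variable {n p : ℕ}

/-- The span of the products `X₁ᵀ X₂` with `X₁, X₂ ∈ F`. -/
def gramSpan (F : Submodule ℝ (Matrix (Fin n) (Fin p) ℝ)) :
    Submodule ℝ (Matrix (Fin p) (Fin p) ℝ) :=
  Submodule.span ℝ {T | ∃ X₁ ∈ F, ∃ X₂ ∈ F, T = X₁ᵀ * X₂}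

theorem gram_mem {F : Submodule ℝ (Matrix (Fin n) (Fin p) ℝ)} (X Y : F) :
    (X : Matrix (Fin n) (Fin p) ℝ)ᵀ * (Y : Matrix (Fin n) (Fin p) ℝ) ∈ gramSpan F :=
  Submodule.subset_span ⟨X, X.2, Y, Y.2, rfl⟩

theorem transpose_mem {F : Submodule ℝ (Matrix (Fin n) (Fin p) ℝ)}
    {T : Matrix (Fin p) (Fin p) ℝ} (hT : T ∈ gramSpan F) : Tᵀ ∈ gramSpan F := by
  induction hT using Submodule.span_induction with
  | mem T h =>
    obtain ⟨X, hX, Y, hY, rfl⟩ := h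
    exact Submodule.subset_span ⟨Y, hY, X, hX, by simp⟩
  | zero => simp
  | add S T _ _ hS hT => simpa using add_mem hS hT
  | smul r T _ hT => simpa using Submodule.smul_mem _ r hT

/-- The product `X T ∈ F` of `X ∈ F` and `T ∈ gramSpan F`. -/
def rightMul {F : Submodule ℝ (Matrix (Fin n) (Fin p) ℝ)}
    (hF : ∀ X ∈ F, ∀ T ∈ gramSpan F, X * T ∈ F) (X : F) (T : gramSpan F) : F :=
  ⟨(X : Matrix (Fin n) (Fin p) ℝ) * (T : Matrix (Fin p) (Fin p) ℝ), hF X X.2 T T.2⟩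

/-- The standing assumptions on `F`, `φ` and `ψ`, apart from the closedness of `F` under right
multiplication by `gramSpan F`. -/
structure Admissible {F : Submodule ℝ (Matrix (Fin n) (Fin p) ℝ)}
    (hF : ∀ X ∈ F, ∀ T ∈ gramSpan F, X * T ∈ F)
    (φ : F →ₗ[ℝ] F) (ψ : gramSpan F →ₗ[ℝ] gramSpan F) : Prop where
  injective : Function.Injective φ
  selfAdjoint : ∀ X Y : F, ⟪φ X, Y⟫ = ⟪X, φ Y⟫
  map_mul : ∀ (X : F) (T : gramSpan F), φ (rightMul hF X T) = rightMul hF (φ X) (ψ T)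
  map_gram : ∀ X : F, ψ ⟨_, gram_mem (φ X) X⟩ = ⟨_, gram_mem X (φ X)⟩

/-- The feasible region `{X ∈ F : Xᵀ φ(X) = I}`. -/
def feasible {F : Submodule ℝ (Matrix (Fin n) (Fin p) ℝ)} (φ : F →ₗ[ℝ] F) : Set F :=
  {X | (X : Matrix (Fin n) (Fin p) ℝ)ᵀ * (φ X : Matrix (Fin n) (Fin p) ℝ) = 1}

/-- The generalized symmetrization `Φ(T) = Tᵀ + ψ(T)`. -/
def genSym {F : Submodule ℝ (Matrix (Fin n) (Fin p) ℝ)}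
    (ψ : gramSpan F →ₗ[ℝ] gramSpan F) (T : gramSpan F) : gramSpan F :=
  ⟨(T : Matrix (Fin p) (Fin p) ℝ)ᵀ, transpose_mem T.2⟩ + ψ T

/-- `S` solves the problem of minimizing `‖φ(X) S - D‖²` over `S` in the range of `Φ`. -/
def IsLeastSquares {F : Submodule ℝ (Matrix (Fin n) (Fin p) ℝ)} (φ : F →ₗ[ℝ] F)
    (ψ : gramSpan F →ₗ[ℝ] gramSpan F) (X D : F) (S : gramSpan F) : Prop :=
  S ∈ range (genSym ψ) ∧
    IsMinOn (fun S' : gramSpan F =>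
      ‖(φ X : Matrix (Fin n) (Fin p) ℝ) * (S' : Matrix (Fin p) (Fin p) ℝ) -
        (D : Matrix (Fin n) (Fin p) ℝ)‖ ^ 2) (range (genSym ψ)) S

/-- `Θ_X(D)`, the solution of the least-squares problem. -/
def leastSquaresSol {F : Submodule ℝ (Matrix (Fin n) (Fin p) ℝ)} (φ : F →ₗ[ℝ] F)
    (ψ : gramSpan F →ₗ[ℝ] gramSpan F) (X D : F) : gramSpan F :=
  Classical.epsilon (IsLeastSquares φ ψ X D)

end GOOCP

end

/-!
The feasible region is an intersection of quadrics, and everything is read off from that.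

Let `X` be feasible. Testing the self-adjointness of `φ` on the elements `X S` and `X T` of `F`
shows that `ψ` is self-adjoint (`GOOCP.Admissible.inner_psi_left`), which yields the polarized
relation `ψ(φ(Y)ᵀ Z) = Yᵀ φ(Z)` (`GOOCP.Admissible.psi_gram`). Consequently `Φ(T) = Tᵀ + ψ(T)` is
self-adjoint, `Φ(φ(Y)ᵀ Z) = Zᵀ φ(Y) + Yᵀ φ(Z)` is symmetric in `Y` and `Z`, and for `S` in the
range of `Φ` the operator `Y ↦ φ(Y) S` is self-adjoint. The region is a common level set of the
quadratic forms `⟪φ(Y) S, Y⟫`, and `S ↦ φ(Y) S` is injective at its points, because `Yᵀ` inverts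
it (`GOOCP.Admissible.isQuadricIntersection`).

The rest holds for any set `M` that is cut out in a Euclidean space by equations
`⟪N x s, x⟫ = c s` with `N` bilinear, `x ↦ N x s` self-adjoint, and `N x` injective for `x ∈ M`.
By the implicit function theorem the tangent space at `x` is the kernel of the adjoint `(N x)†`, so that the
normal space is the range of `N x` (`mem_tangentSpace_iff`). The projection to the tangent space
is `D - N x (θ x D)`, where `θ x D` solves the normal equations, that is, the least-squares
problem (`tangentProj_eq`, `isMinOn_norm_sub_sq_iff`). This gives the gradient.

The tangential part of the Euclidean derivative is a Levi-Civita connection: the bracket of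
tangent fields is tangent because the second derivative of the constraint is symmetric
(`lieBracketWithin_mem`). Koszul's argument shows that any other one agrees with it on the fields
differentiable at the point; it needs the tangent fields `y ↦ P_y z`, which are differentiable
since `θ` is (`IsRiemannianConnection.eq_of_differentiableWithinAt`). For the Hessian,
`∇ f y - N y (θ y (∇ f y))` is differentiated with the product rule, and the term containing
the derivative of `θ` is normal, hence removed by the projection (`riemannianHessian_apply`).
-/

noncomputable section

namespace EmbeddedRiemannian

variable {E : Type*} [NormedAddCommGroup E] [InnerProductSpace ℝ E] {M : Set E} {x : E}

/-! ### Derivatives within a subset of a Euclidean space -/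

/-- Although derivatives within `M` need not be unique, they are determined on tangent vectors. -/
theorem hasFDerivWithinAt_unique_on_tangentSpace {G : Type*} [NormedAddCommGroup G]
    [NormedSpace ℝ G] {g : E → G} {A B : E →L[ℝ] G} (hA : HasFDerivWithinAt g A M x)
    (hB : HasFDerivWithinAt g B M x) {v : E} (hv : v ∈ tangentSpace M x) : A v = B v := by
  induction hv using Submodule.span_induction with
  | mem v h =>
    obtain ⟨ε, γ, hε, -, hM, h0, hd⟩ := h
    have hmaps : MapsTo γ (Ioo (-ε) ε) M := hM
    have hnhds : Ioo (-ε) ε ∈ 𝓝 (0 : ℝ) := Ioo_mem_nhds (by linarith) hε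
    have key : ∀ C : E →L[ℝ] G, HasFDerivWithinAt g C M x → HasDerivAt (g ∘ γ) (C v) 0 := by
      intro C hC
      rw [← h0] at hC
      exact (hC.comp_hasDerivWithinAt 0 hd.hasDerivWithinAt hmaps).hasDerivAt hnhds
    exact (key A hA).unique (key B hB)
  | zero => simp
  | add v w _ _ hv hw => simp [hv, hw]
  | smul r v _ hv => simp [hv]

theorem fderivWithin_apply_of_mem_tangentSpace {G : Type*} [NormedAddCommGroup G]
    [NormedSpace ℝ G] {g : E → G} {A : E →L[ℝ] G} (hA : HasFDerivWithinAt g A M x)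
    {v : E} (hv : v ∈ tangentSpace M x) : fderivWithin ℝ g M x v = A v :=
  hasFDerivWithinAt_unique_on_tangentSpace hA.differentiableWithinAt.hasFDerivWithinAt hA hv

/-! ### Uniqueness of the Levi-Civita connection -/

/-- Koszul's argument: where every tangent vector extends to a tangent field that is differentiable
at the point, metric compatibility makes the difference of two Levi-Civita connections
antisymmetric in its last two arguments, and freeness of torsion makes it symmetric in its first
two, so that it vanishes. -/
theorem IsRiemannianConnection.eq_of_differentiableWithinAt {D D' : CovDeriv M}
    (hD : IsRiemannianConnection M D) (hD' : IsRiemannianConnection M D') (hx : x ∈ M)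
    (hext : ∀ z ∈ tangentSpace M x, ∃ U : E → E, IsTangentField M U ∧
      DifferentiableWithinAt ℝ U M x ∧ U x = z)
    {V : E → E} (hVt : IsTangentField M V) (hV : DifferentiableWithinAt ℝ V M x) :
    D V x = D' V x := by
  have hanti : ∀ V W : E → E, IsTangentField M V → IsTangentField M W →
      DifferentiableWithinAt ℝ V M x → DifferentiableWithinAt ℝ W M x →
      ∀ z : tangentSpace M x, ⟪(D V x z : E) - D' V x z, W x⟫ =
        -⟪(D W x z : E) - D' W x z, V x⟫ := by
    intro V W hVt hWt hV hW z
    have h1 := hD.metric V W hVt hWt x hx hV hW z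
    have h2 := hD'.metric V W hVt hWt x hx hV hW z
    rw [inner_sub_left, inner_sub_left, real_inner_comm (V x), real_inner_comm (V x)]
    linarith
  have hsymm : ∀ (U V : E → E) (hUt : IsTangentField M U) (hVt : IsTangentField M V),
      DifferentiableWithinAt ℝ U M x → DifferentiableWithinAt ℝ V M x →
      (D V x ⟨U x, hUt x hx⟩ : E) - D' V x ⟨U x, hUt x hx⟩ =
        D U x ⟨V x, hVt x hx⟩ - D' U x ⟨V x, hVt x hx⟩ := by
    intro U V hUt hVt hU hV
    have h1 := hD.torsion_free U V hUt hVt x hx hU hV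
    rw [← hD'.torsion_free U V hUt hVt x hx hU hV] at h1
    rw [sub_eq_sub_iff_sub_eq_sub]
    exact h1
  ext z
  obtain ⟨U, hUt, hU, hUz⟩ := hext z z.2
  have hz : z = ⟨U x, hUt x hx⟩ := Subtype.ext hUz.symm
  obtain ⟨W, hWt, hW, hWx⟩ := hext _ (D V x z - D' V x z).2
  rw [hz, ← sub_eq_zero, ← inner_self_eq_zero (𝕜 := ℝ)]
  have hW' : (D V x ⟨U x, hUt x hx⟩ : E) - D' V x ⟨U x, hUt x hx⟩ = W x := by
    rw [hWx, hz]; rfl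
  nth_rewrite 2 [hW']
  -- With `a U V W` for the inner product of the difference `D V - D' V` along `U` with `W`,
  -- `a U V W = - a W U V = a V W U = - a U V W`.
  have e1 := hanti V W hVt hWt hV hW ⟨U x, hUt x hx⟩
  rw [hsymm U W hUt hWt hU hW] at e1
  have e2 := hanti U V hUt hVt hU hV ⟨W x, hWt x hx⟩
  rw [hsymm W V hWt hVt hW hV] at e2
  have e3 := hanti W U hWt hUt hW hU ⟨V x, hVt x hx⟩
  rw [← hsymm U V hUt hVt hU hV] at e3
  linarith

end EmbeddedRiemannian

/-! ### Tangential projection and tangential derivative -/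

namespace EmbeddedRiemannian

variable {E : Type*} [NormedAddCommGroup E] [InnerProductSpace ℝ E] [FiniteDimensional ℝ E]
  {M : Set E} {x : E}

theorem tangentProj_mem (v : E) : tangentProj M x v ∈ tangentSpace M x :=
  Submodule.starProjection_apply_mem _ v

theorem tangentProj_of_mem {v : E} (hv : v ∈ tangentSpace M x) : tangentProj M x v = v :=
  Submodule.starProjection_eq_self_iff.2 hv

theorem inner_tangentProj_left {w : E} (hw : w ∈ tangentSpace M x) (v : E) :
    ⟪tangentProj M x v, w⟫ = ⟪v, w⟫ := by
  rw [tangentProj, Submodule.inner_starProjection_left_eq_right]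
  exact congrArg _ (tangentProj_of_mem hw)

/-- The Riemannian gradient is the orthogonal projection of the Euclidean one. -/
theorem riemannianGradient_eq_tangentProj {f : E → ℝ} (hf : DifferentiableAt ℝ f x) :
    (riemannianGradient M f x : E) = tangentProj M x (∇ f x) := by
  have key : ∀ u ∈ tangentSpace M x,
      ⟪(riemannianGradient M f x : E), u⟫ = ⟪tangentProj M x (∇ f x), u⟫ := by
    intro u hu
    rw [inner_tangentProj_left hu]
    have h1 : ⟪riemannianGradient M f x, (⟨u, hu⟩ : tangentSpace M x)⟫ =
        fderivWithin ℝ f M x u := by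
      rw [riemannianGradient, InnerProductSpace.toDual_symm_apply]
      rfl
    refine h1.trans ?_
    rw [fderivWithin_apply_of_mem_tangentSpace hf.hasFDerivAt.hasFDerivWithinAt hu]
    simp [gradient]
  have hmem : (riemannianGradient M f x : E) - tangentProj M x (∇ f x) ∈ tangentSpace M x :=
    sub_mem (riemannianGradient M f x).2 (tangentProj_mem _)
  rw [← sub_eq_zero, ← inner_self_eq_zero (𝕜 := ℝ), inner_sub_left, key _ hmem, sub_self]

/-- The tangential part `z ↦ P (dV z)` of the derivative of `V`. -/
def tangentialDeriv (M : Set E) : CovDeriv M := fun V x =>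
  ((tangentSpace M x).orthogonalProjectionOnto ∘L fderivWithin ℝ V M x ∘L
    (tangentSpace M x).subtypeL).toLinearMap

theorem coe_tangentialDeriv (V : E → E) (z : tangentSpace M x) :
    (tangentialDeriv M V x z : E) = tangentProj M x (fderivWithin ℝ V M x z) := rfl

/-- The tangential derivative satisfies all laws of the Levi-Civita connection as soon as the
brackets `dV(U) - dU(V)` of tangent fields are tangent. -/
theorem isRiemannianConnection_tangentialDeriv
    (hM : ∀ U V : E → E, IsTangentField M U → IsTangentField M V → ∀ x ∈ M,
      DifferentiableWithinAt ℝ U M x → DifferentiableWithinAt ℝ V M x →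
      VectorField.lieBracketWithin ℝ U V M x ∈ tangentSpace M x) :
    IsRiemannianConnection M (tangentialDeriv M) where
  congr V W _ _ h x hx := by
    ext z
    rw [coe_tangentialDeriv, coe_tangentialDeriv, fderivWithin_congr h (h hx)]
  add V W _ _ x _ hV hW := by
    ext z
    rw [coe_tangentialDeriv, fderivWithin_apply_of_mem_tangentSpace
      (hV.hasFDerivWithinAt.fun_add hW.hasFDerivWithinAt) z.2]
    simp [coe_tangentialDeriv]
  leibniz g V hVt x hx hg hV z := by
    rw [coe_tangentialDeriv, fderivWithin_apply_of_mem_tangentSpace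
      (hg.hasFDerivWithinAt.fun_smul hV.hasFDerivWithinAt) z.2]
    simp [coe_tangentialDeriv, tangentProj_of_mem (hVt x hx)]
  metric V W hVt hWt x hx hV hW z := by
    rw [coe_tangentialDeriv, coe_tangentialDeriv, fderivWithin_apply_of_mem_tangentSpace
      (hV.hasFDerivWithinAt.inner ℝ hW.hasFDerivWithinAt) z.2, inner_tangentProj_left (hWt x hx),
      real_inner_comm (tangentProj M x _), inner_tangentProj_left (hVt x hx)]
    simp [fderivInnerCLM_apply, real_inner_comm, add_comm]
  torsion_free U V hUt hVt x hx hU hV := by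
    rw [coe_tangentialDeriv, coe_tangentialDeriv, ← map_sub]
    exact tangentProj_of_mem (hM U V hUt hVt x hx hU hV)

end EmbeddedRiemannian

/-! ### Intersections of quadrics -/

namespace EmbeddedRiemannian

variable {E W : Type*} [NormedAddCommGroup E] [InnerProductSpace ℝ E] [FiniteDimensional ℝ E]
  [NormedAddCommGroup W] [InnerProductSpace ℝ W] [FiniteDimensional ℝ W]

/-- A family of operators `x ↦ N x s` on `E` that depends linearly on the parameter `s : W`, as a
bilinear map. The topologies in this type are those of the norms, also when `E` and `W` are spaces
of matrices, for which instance search finds the product topology. -/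
abbrev OperatorFamily (E W : Type*) [NormedAddCommGroup E] [InnerProductSpace ℝ E]
    [NormedAddCommGroup W] [InnerProductSpace ℝ W] : Type _ :=
  E →L[ℝ] W →L[ℝ] E

/-- The continuity of a bilinear map is automatic in finite dimension. -/
def operatorFamily (B : E →ₗ[ℝ] W →ₗ[ℝ] E) : OperatorFamily E W :=
  B.toContinuousBilinearMap

/-- The operators `x ↦ N x s` are self-adjoint, and `M` is empty or a common level set of their
quadratic forms `x ↦ ⟪N x s, x⟫`. On `M` the map `N x` is injective, which says that the constraints
are independent. -/
structure IsQuadricIntersection (N : OperatorFamily E W) (M : Set E) : Prop where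
  symm : ∀ x y s, ⟪N x s, y⟫ = ⟪x, N y s⟫
  level : ∀ x ∈ M, ∀ y, y ∈ M ↔ ∀ s, ⟪N y s, y⟫ = ⟪N x s, x⟫
  injective : ∀ x ∈ M, Function.Injective (N x)

/-- The bilinear map `(x, y) ↦ (N x)† y`. Where it is symmetric, half the differential at `x` of the
constraint `x ↦ (N x)† x`. -/
def constraintForm (N : OperatorFamily E W) : E →L[ℝ] E →L[ℝ] W :=
  LinearMap.toContinuousLinearMap
    { toFun := fun x => ContinuousLinearMap.adjoint (N x)
      map_add' := fun x y => by simp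
      map_smul' := fun r x => by simp }

variable {N : OperatorFamily E W} {M : Set E} {x : E}

theorem inner_constraintForm_left (x y : E) (s : W) : ⟪constraintForm N x y, s⟫ = ⟪y, N x s⟫ :=
  ContinuousLinearMap.adjoint_inner_left _ _ _

/-- The coefficient `s` for which `N x s` is the component of `D` normal to `M`, computed from the
normal equations `(N x)† (N x s) = (N x)† D`. -/
def normalCoeff (N : OperatorFamily E W) (x : E) : E →L[ℝ] W :=
  Ring.inverse (constraintForm N x ∘L N x) ∘L constraintForm N x

namespace IsQuadricIntersection

variable (h : IsQuadricIntersection N M)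
include h

theorem constraintForm_comm (x y : E) : constraintForm N x y = constraintForm N y x :=
  ext_inner_right ℝ fun s => by
    rw [inner_constraintForm_left, inner_constraintForm_left, ← h.symm, real_inner_comm]

theorem mem_iff (hx : x ∈ M) (y : E) : y ∈ M ↔ constraintForm N y y = constraintForm N x x := by
  rw [h.level x hx, ext_iff_inner_right ℝ]
  simp_rw [inner_constraintForm_left, real_inner_comm]

theorem isUnit_gram (hx : x ∈ M) : IsUnit (constraintForm N x ∘L N x) := by
  have hinj : Function.Injective (constraintForm N x ∘L N x).toLinearMap := by
    rw [injective_iff_map_eq_zero]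
    intro s hs
    have h0 : ⟪constraintForm N x (N x s), s⟫ = 0 := by
      rw [show constraintForm N x (N x s) = 0 from hs, inner_zero_left]
    rw [inner_constraintForm_left, inner_self_eq_zero] at h0
    exact h.injective x hx (by rw [h0, map_zero])
  rw [ContinuousLinearMap.isUnit_iff_bijective]
  exact ⟨hinj, LinearMap.injective_iff_surjective.1 hinj⟩

theorem constraintForm_normalCoeff (hx : x ∈ M) (D : E) :
    constraintForm N x (N x (normalCoeff N x D)) = constraintForm N x D := by
  have := congrArg (fun A : W →L[ℝ] W => A (constraintForm N x D))
    (Ring.mul_inverse_cancel _ (h.isUnit_gram hx))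
  exact this

/-- A vector annihilated by the differential of the constraint is the velocity of a curve
`x + t v + N x s(t)`, where `s(t)` comes from the implicit function theorem. -/
theorem mem_velocities (hx : x ∈ M) {v : E} (hv : constraintForm N x v = 0) :
    v ∈ velocities M x := by
  set K := constraintForm N
  -- The constraint is a polynomial, so the implicit function is analytic; smoothness at `0` alone
  -- would not give an interval on which the curve has derivatives of all orders.
  let y : ℝ × W → E := fun q => x + (q.1 • v + N x q.2)
  let y' : ℝ × W →L[ℝ] E :=
    (ContinuousLinearMap.fst ℝ ℝ W).smulRight v + N x ∘L ContinuousLinearMap.snd ℝ ℝ W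
  have hy : ∀ q, HasFDerivAt y y' q := fun q => (y'.hasFDerivAt).const_add x
  have hys : ContDiff ℝ ω y := contDiff_const.add y'.contDiff
  let H : ℝ × W → W := fun q => K (y q) (y q)
  have hH : ContDiffAt ℝ ω H (0, 0) :=
    ((K.contDiff.comp hys).clm_apply hys).contDiffAt
  have hy0 : y (0, 0) = x := by simp [y]
  have hH' : ∀ q, fderiv ℝ H (0, 0) q = (2 : ℝ) • K x (y' q) := by
    intro q
    have h1 := ((K.hasFDerivAt (x := y (0, 0))).comp (0, 0) (hy (0, 0))).clm_apply (hy (0, 0))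
    have h2 : HasFDerivAt H _ (0, 0) := h1
    rw [h2.fderiv, hy0]
    simp only [add_apply, ContinuousLinearMap.comp_apply,
      ContinuousLinearMap.flip_apply, Function.comp_apply, hy0]
    rw [h.constraintForm_comm (y' q) x, two_smul]
  have hinv : (fderiv ℝ H (0, 0) ∘L .inr ℝ ℝ W).IsInvertible := by
    have h1 : fderiv ℝ H (0, 0) ∘L .inr ℝ ℝ W = (2 : ℝ) • (K x ∘L N x) := by
      ext s
      simp [hH', y']
    have h2 : IsUnit ((2 : ℝ) • (K x ∘L N x)) :=
      (isUnit_smul_iff (Units.mk0 (2 : ℝ) two_ne_zero) _).2 (h.isUnit_gram hx)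
    rw [h1]
    obtain ⟨u, hu⟩ := h2
    exact ⟨ContinuousLinearEquiv.ofUnit u, hu⟩
  let σ := hH.implicitFunction (by simp) hinv
  have hσ0 : σ 0 = 0 := hH.implicitFunction_apply_self (by simp) hinv
  have hσM : ∀ᶠ t in 𝓝 (0 : ℝ), H (t, σ t) = H (0, 0) :=
    hH.eventually_apply_implicitFunction (by simp) hinv
  have hσs : ContDiffAt ℝ ω σ 0 := hH.contDiffAt_implicitFunction (by simp) hinv
  have hσd : HasDerivAt σ 0 0 := by
    have h1 := (hH.hasStrictFDerivAt_implicitFunction (by simp) hinv).hasFDerivAt.hasDerivAt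
    have h2 : fderiv ℝ H (0, 0) ((1 : ℝ), (0 : W)) = 0 := by simp [hH', y', hv]
    simpa [h2] using h1
  obtain ⟨ε, hε, hball⟩ := Metric.eventually_nhds_iff.1
    (hσM.and (hσs.eventually (by simp)))
  have hmem : ∀ t ∈ Ioo (-ε) ε, H (t, σ t) = H (0, 0) ∧ ContDiffAt ℝ ω σ t := fun t ht =>
    hball (by rw [Real.dist_eq, sub_zero]; exact abs_lt.2 ht)
  refine ⟨ε, fun t => y (t, σ t), hε, fun t ht => ?_, fun t ht => ?_, ?_, ?_⟩
  · have h1 : ContDiffAt ℝ ω (fun t => y (t, σ t)) t :=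
      hys.contDiffAt.comp t (contDiffAt_id.prodMk (hmem t ht).2)
    exact (h1.of_le le_top).contDiffWithinAt
  · rw [h.mem_iff hx]
    have h1 := (hmem t ht).1
    simp only [H, hy0] at h1
    exact h1
  · simp [hσ0, hy0]
  · have h1 := (hy (0, σ 0)).comp_hasDerivAt (0 : ℝ) ((hasDerivAt_id (0 : ℝ)).prodMk hσd)
    have h2 : y' ((1 : ℝ), (0 : W)) = v := by simp [y']
    rw [h2] at h1
    exact h1

theorem mem_tangentSpace_iff (hx : x ∈ M) {v : E} :
    v ∈ tangentSpace M x ↔ constraintForm N x v = 0 := by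
  refine ⟨fun hv => ?_, fun hv => Submodule.subset_span (h.mem_velocities hx hv)⟩
  -- The constraint is constant on `M`, so `0` is among its derivatives within `M`.
  have h1 : HasFDerivWithinAt (fun y => constraintForm N y y) (0 : E →L[ℝ] W) M x :=
    (hasFDerivWithinAt_const (constraintForm N x x) x M).congr
      (fun y hy => (h.mem_iff hx y).1 hy) rfl
  have h2 := (((constraintForm N).hasFDerivAt (x := x)).clm_apply
    (hasFDerivAt_id x)).hasFDerivWithinAt (s := M)
  have h3 := hasFDerivWithinAt_unique_on_tangentSpace h1 h2 hv
  simp only [zero_apply, add_apply,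
    ContinuousLinearMap.comp_apply, ContinuousLinearMap.flip_apply, id_eq,
    ContinuousLinearMap.id_apply] at h3
  rw [h.constraintForm_comm v x, ← two_smul ℝ] at h3
  exact (smul_eq_zero_iff_right two_ne_zero).1 h3.symm

theorem inner_normal_eq_zero (hx : x ∈ M) (s : W) {v : E} (hv : v ∈ tangentSpace M x) :
    ⟪N x s, v⟫ = 0 := by
  rw [real_inner_comm, ← inner_constraintForm_left, (h.mem_tangentSpace_iff hx).1 hv,
    inner_zero_left]

theorem tangentProj_eq (hx : x ∈ M) (D : E) :
    tangentProj M x D = D - N x (normalCoeff N x D) := by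
  refine Submodule.eq_starProjection_of_mem_of_inner_eq_zero ?_ fun w hw => ?_
  · rw [h.mem_tangentSpace_iff hx, map_sub, h.constraintForm_normalCoeff hx, sub_self]
  · rw [sub_sub_cancel, h.inner_normal_eq_zero hx _ hw]

theorem tangentProj_normal (hx : x ∈ M) (s : W) : tangentProj M x (N x s) = 0 :=
  Submodule.eq_starProjection_of_mem_of_inner_eq_zero (zero_mem _) fun w hw => by
    rw [sub_zero, h.inner_normal_eq_zero hx s hw]

theorem differentiableAt_normalCoeff (hx : x ∈ M) :
    DifferentiableAt ℝ (normalCoeff N) x := by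
  have hK : Differentiable ℝ (constraintForm N) := (constraintForm N).differentiable
  have h1 : DifferentiableAt ℝ (fun y => constraintForm N y ∘L N y) x :=
    (hK x).clm_comp N.differentiableAt
  exact ((differentiableAt_inverse (𝕜 := ℝ) (h.isUnit_gram hx)).comp x h1).clm_comp (hK x)

/-- On `M` the projection `D ↦ D - N y (normalCoeff N y D)` depends differentiably on the foot
point, so that the tangential part of a differentiable field is differentiable. -/
theorem hasFDerivWithinAt_tangentProj (hx : x ∈ M) {V : E → E} {V' : E →L[ℝ] E}
    (hV : HasFDerivAt V V' x) :
    ∃ A : E →L[ℝ] W, HasFDerivWithinAt (fun y => tangentProj M y (V y))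
      (V' - (N x ∘L A + N.flip (normalCoeff N x (V x)))) M x := by
  have hΘ : DifferentiableAt ℝ (fun y => normalCoeff N y (V y)) x :=
    (h.differentiableAt_normalCoeff hx).clm_apply hV.differentiableAt
  refine ⟨fderiv ℝ (fun y => normalCoeff N y (V y)) x, ?_⟩
  have h1 := hV.sub ((N.hasFDerivAt (x := x)).clm_apply hΘ.hasFDerivAt)
  exact h1.hasFDerivWithinAt.congr (fun y hy => h.tangentProj_eq hy _) (h.tangentProj_eq hx _)

/-- The bracket of tangent fields is tangent: differentiating `(N y)† (V y) = 0` along `U` gives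
`(N U)† V + (N x)† (dV U) = 0`, whose first term is symmetric in `U` and `V`. -/
theorem lieBracketWithin_mem {U V : E → E} (hUt : IsTangentField M U) (hVt : IsTangentField M V)
    (hx : x ∈ M) (hU : DifferentiableWithinAt ℝ U M x) (hV : DifferentiableWithinAt ℝ V M x) :
    VectorField.lieBracketWithin ℝ U V M x ∈ tangentSpace M x := by
  have key : ∀ V : E → E, IsTangentField M V → DifferentiableWithinAt ℝ V M x →
      ∀ u ∈ tangentSpace M x,
        constraintForm N x (fderivWithin ℝ V M x u) = -constraintForm N u (V x) := by
    intro V hVt hV u hu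
    have h1 : HasFDerivWithinAt (fun y => constraintForm N y (V y)) (0 : E →L[ℝ] W) M x :=
      (hasFDerivWithinAt_const (0 : W) x M).congr
        (fun y hy => (h.mem_tangentSpace_iff hy).1 (hVt y hy))
        ((h.mem_tangentSpace_iff hx).1 (hVt x hx))
    have h2 := ((constraintForm N).hasFDerivAt (x := x)).hasFDerivWithinAt (s := M) |>.clm_apply
      hV.hasFDerivWithinAt
    have h3 := hasFDerivWithinAt_unique_on_tangentSpace h1 h2 hu
    simp only [zero_apply, add_apply,
      ContinuousLinearMap.comp_apply, ContinuousLinearMap.flip_apply] at h3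
    exact eq_neg_of_add_eq_zero_left h3.symm
  rw [h.mem_tangentSpace_iff hx, VectorField.lieBracketWithin, map_sub,
    key V hVt hV _ (hUt x hx), key U hUt hU _ (hVt x hx), h.constraintForm_comm, sub_self]

theorem isRiemannianConnection_riemannianConnection :
    IsRiemannianConnection M (riemannianConnection M) :=
  Classical.epsilon_spec ⟨tangentialDeriv M, isRiemannianConnection_tangentialDeriv
    fun _ _ hUt hVt _ hx hU hV => h.lieBracketWithin_mem hUt hVt hx hU hV⟩

theorem riemannianConnection_eq_tangentialDeriv (hx : x ∈ M) {V : E → E}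
    (hVt : IsTangentField M V) (hV : DifferentiableWithinAt ℝ V M x) :
    riemannianConnection M V x = tangentialDeriv M V x := by
  refine h.isRiemannianConnection_riemannianConnection.eq_of_differentiableWithinAt
    (isRiemannianConnection_tangentialDeriv
      fun _ _ hUt hVt _ hx hU hV => h.lieBracketWithin_mem hUt hVt hx hU hV) hx
    (fun z hz => ⟨fun y => tangentProj M y z, fun y _ => tangentProj_mem z, ?_,
      tangentProj_of_mem hz⟩) hVt hV
  obtain ⟨A, hA⟩ := h.hasFDerivWithinAt_tangentProj hx (hasFDerivAt_const z x)
  exact hA.differentiableWithinAt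

theorem exists_hasFDerivWithinAt_gradientField (hx : x ∈ M) {f : E → ℝ} (hf : Differentiable ℝ f)
    (hf' : DifferentiableAt ℝ (∇ f) x) :
    ∃ A : E →L[ℝ] W, HasFDerivWithinAt (gradientField M f)
      (fderiv ℝ (∇ f) x - (N x ∘L A + N.flip (normalCoeff N x (∇ f x)))) M x := by
  obtain ⟨A, hA⟩ := h.hasFDerivWithinAt_tangentProj hx hf'.hasFDerivAt
  exact ⟨A, hA.congr (fun y _ => riemannianGradient_eq_tangentProj (hf y))
    (riemannianGradient_eq_tangentProj (hf x))⟩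

/-- In the derivative of `y ↦ ∇ f y - N y (θ y)` the term with the derivative of `θ` is normal, and
the projection removes it. -/
theorem riemannianHessian_apply (hx : x ∈ M) {f : E → ℝ} (hf : Differentiable ℝ f)
    (hf' : DifferentiableAt ℝ (∇ f) x) (z : tangentSpace M x) :
    (riemannianHessian M f x z : E) =
      tangentProj M x (fderiv ℝ (∇ f) x z - N z (normalCoeff N x (∇ f x))) := by
  obtain ⟨A, hA⟩ := h.exists_hasFDerivWithinAt_gradientField hx hf hf'
  have hgrad : IsTangentField M (gradientField M f) := fun y _ => (riemannianGradient M f y).2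
  rw [riemannianHessian, h.riemannianConnection_eq_tangentialDeriv hx hgrad
    hA.differentiableWithinAt, coe_tangentialDeriv,
    fderivWithin_apply_of_mem_tangentSpace hA z.2]
  simp [h.tangentProj_normal hx]

/-- `D - N x (normalCoeff N x D)` is orthogonal to the range of `N x`, and Pythagoras gives the
minimizers. -/
theorem isMinOn_norm_sub_sq_iff (hx : x ∈ M) (D : E) (s : W) :
    IsMinOn (fun s => ‖N x s - D‖ ^ 2) univ s ↔ s = normalCoeff N x D := by
  set θ := normalCoeff N x D
  have hval : ∀ s, ‖N x s - D‖ ^ 2 = ‖N x θ - D‖ ^ 2 + ‖N x (s - θ)‖ ^ 2 := by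
    intro s
    have h0 : ⟪N x θ - D, N x (s - θ)⟫ = 0 := by
      rw [← inner_constraintForm_left, map_sub, h.constraintForm_normalCoeff hx, sub_self,
        inner_zero_left]
    have h1 : N x s - D = (N x θ - D) + N x (s - θ) := by
      rw [map_sub]; abel
    rw [h1, norm_add_sq_real, h0]
    ring
  constructor
  · intro hmin
    have h1 : ‖N x s - D‖ ^ 2 ≤ ‖N x θ - D‖ ^ 2 := hmin (mem_univ θ)
    rw [hval s] at h1
    have h2 : ‖N x (s - θ)‖ = 0 :=
      (pow_eq_zero_iff two_ne_zero).1 (le_antisymm (by linarith) (sq_nonneg _))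
    rw [norm_eq_zero, map_sub, sub_eq_zero] at h2
    exact h.injective x hx h2
  · rintro rfl s -
    change ‖N x θ - D‖ ^ 2 ≤ ‖N x s - D‖ ^ 2
    rw [hval s]
    exact le_add_of_nonneg_right (sq_nonneg _)

end IsQuadricIntersection

end EmbeddedRiemannian

/-! ### The feasible region as an intersection of quadrics -/

namespace GOOCP

open EmbeddedRiemannian

variable {n p : ℕ} {F : Submodule ℝ (Matrix (Fin n) (Fin p) ℝ)}
  {hF : ∀ X ∈ F, ∀ T ∈ gramSpan F, X * T ∈ F}
  {φ : F →ₗ[ℝ] F} {ψ : gramSpan F →ₗ[ℝ] gramSpan F} {X : F}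

/-- The product `Xᵀ Y` of `X, Y ∈ F`, as an element of `gramSpan F`. -/
def gram (X Y : F) : gramSpan F := ⟨_, gram_mem X Y⟩

/-- The transpose as a linear map on `gramSpan F`. -/
def gramTranspose (F : Submodule ℝ (Matrix (Fin n) (Fin p) ℝ)) : gramSpan F →ₗ[ℝ] gramSpan F where
  toFun T := ⟨(T : Matrix (Fin p) (Fin p) ℝ)ᵀ, transpose_mem T.2⟩
  map_add' S T := by ext : 1; simp
  map_smul' r T := by ext : 1; simp

/-- The generalized symmetrization `genSym ψ` as a linear map. -/
def genSymLinear (ψ : gramSpan F →ₗ[ℝ] gramSpan F) : gramSpan F →ₗ[ℝ] gramSpan F :=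
  gramTranspose F + ψ

theorem genSymLinear_apply (T : gramSpan F) :
    genSymLinear ψ T = gramTranspose F T + ψ T := rfl

theorem gramTranspose_gram (X Y : F) : gramTranspose F (gram X Y) = gram Y X :=
  Subtype.ext (by simp [gramTranspose, gram])

theorem inner_gramTranspose_left (S T : gramSpan F) :
    ⟪gramTranspose F S, T⟫ = ⟪S, gramTranspose F T⟫ := by
  change Matrix.trace ((S : Matrix (Fin p) (Fin p) ℝ)ᵀᵀ * (T : Matrix (Fin p) (Fin p) ℝ)) =
    Matrix.trace ((S : Matrix (Fin p) (Fin p) ℝ)ᵀ * (T : Matrix (Fin p) (Fin p) ℝ)ᵀ)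
  rw [← Matrix.transpose_mul, Matrix.trace_transpose, Matrix.transpose_transpose,
    Matrix.trace_mul_comm]

/-- Right multiplication by elements of `gramSpan F` is adjoint to `gram`. -/
theorem inner_rightMul_left (X Y : F) (S : gramSpan F) :
    ⟪rightMul hF X S, Y⟫ = ⟪S, gram X Y⟫ := by
  change Matrix.trace (((X : Matrix (Fin n) (Fin p) ℝ) * (S : Matrix (Fin p) (Fin p) ℝ))ᵀ *
    (Y : Matrix (Fin n) (Fin p) ℝ)) = Matrix.trace ((S : Matrix (Fin p) (Fin p) ℝ)ᵀ *
      ((X : Matrix (Fin n) (Fin p) ℝ)ᵀ * (Y : Matrix (Fin n) (Fin p) ℝ)))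
  rw [Matrix.transpose_mul, Matrix.mul_assoc]

theorem gram_rightMul (X Y : F) (T : gramSpan F) :
    (gram X (rightMul hF Y T) : Matrix (Fin p) (Fin p) ℝ) =
      gram X Y * (T : Matrix (Fin p) (Fin p) ℝ) :=
  (Matrix.mul_assoc _ _ _).symm

/-- The normal vectors `φ(X) S` at `X`, with `S` in the range of the generalized symmetrization. -/
def normalMap (hF : ∀ X ∈ F, ∀ T ∈ gramSpan F, X * T ∈ F) (φ : F →ₗ[ℝ] F)
    (ψ : gramSpan F →ₗ[ℝ] gramSpan F) :
    OperatorFamily F (LinearMap.range (genSymLinear ψ)) :=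
  operatorFamily (LinearMap.mk₂ ℝ
    (fun (X : F) (S : LinearMap.range (genSymLinear ψ)) => rightMul hF (φ X) S)
    (fun X Y S => Subtype.ext (by simp [rightMul, Matrix.add_mul]))
    (fun r X S => Subtype.ext (by simp [rightMul]))
    (fun X S T => Subtype.ext (by simp [rightMul, Matrix.mul_add]))
    (fun r X S => Subtype.ext (by simp [rightMul])))

theorem normalMap_apply (X : F) (S : LinearMap.range (genSymLinear ψ)) :
    normalMap hF φ ψ X S = rightMul hF (φ X) S := rfl

theorem gram_rightMul_left (hX : X ∈ feasible φ) (T : gramSpan F) :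
    gram (φ X) (rightMul hF X T) = T := by
  have h1 : (gram (φ X) X : Matrix (Fin p) (Fin p) ℝ) = 1 := by
    rw [← gramTranspose_gram]
    exact (congrArg Matrix.transpose hX).trans Matrix.transpose_one
  exact Subtype.ext (by rw [gram_rightMul, h1, Matrix.one_mul])

namespace Admissible

variable (hφ : Admissible hF φ ψ) (hX : X ∈ feasible φ)
include hφ hX

theorem gram_map_rightMul (T : gramSpan F) : gram X (φ (rightMul hF X T)) = ψ T := by
  have h1 : (gram X (φ X) : Matrix (Fin p) (Fin p) ℝ) = 1 := hX
  exact Subtype.ext (by rw [hφ.map_mul, gram_rightMul, h1, Matrix.one_mul])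

/-- Once the feasible region contains a point `X`, the self-adjointness of `φ`, tested on the
elements `X S` and `X T`, carries over to `ψ`. -/
theorem inner_psi_left (S T : gramSpan F) : ⟪ψ S, T⟫ = ⟪S, ψ T⟫ := by
  have h1 := hφ.selfAdjoint (rightMul hF X S) (rightMul hF X T)
  rwa [inner_rightMul_left, hφ.gram_map_rightMul hX, hφ.map_mul, inner_rightMul_left,
    gram_rightMul_left hX] at h1

/-- The polarization of the relation `ψ(φ(X)ᵀ X) = Xᵀ φ(X)`. It does not follow from that relation
alone, which only gives the part symmetric in `Y` and `Z`. -/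
theorem psi_gram (Y Z : F) : ψ (gram (φ Y) Z) = gram Y (φ Z) := by
  refine ext_inner_left ℝ fun T => ?_
  rw [← hφ.inner_psi_left hX, ← inner_rightMul_left (hF := hF), ← hφ.map_mul, hφ.selfAdjoint,
    inner_rightMul_left]

theorem inner_genSymLinear_left (S T : gramSpan F) :
    ⟪genSymLinear ψ S, T⟫ = ⟪S, genSymLinear ψ T⟫ := by
  rw [genSymLinear_apply, genSymLinear_apply, inner_add_left, inner_add_right,
    inner_gramTranspose_left, hφ.inner_psi_left hX]

theorem genSymLinear_gram (Y Z : F) :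
    genSymLinear ψ (gram (φ Y) Z) = gram Z (φ Y) + gram Y (φ Z) := by
  rw [genSymLinear_apply, gramTranspose_gram, hφ.psi_gram hX]

theorem inner_normalMap (Y Z : F) (T : gramSpan F) :
    ⟪normalMap hF φ ψ Y ⟨genSymLinear ψ T, T, rfl⟩, Z⟫ = ⟪T, gram Z (φ Y) + gram Y (φ Z)⟫ := by
  rw [normalMap_apply]
  refine (inner_rightMul_left _ _ _).trans ?_
  rw [hφ.inner_genSymLinear_left hX, hφ.genSymLinear_gram hX]

end Admissible

/-- The constraint `Yᵀ φ(Y) = I` is tested against all `T` by the quadratic forms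
`⟪φ(Y) Φ(T), Y⟫ = 2 ⟪T, Yᵀ φ(Y)⟫`. -/
theorem Admissible.isQuadricIntersection (hφ : Admissible hF φ ψ) (hX : X ∈ feasible φ) :
    IsQuadricIntersection (normalMap hF φ ψ) (feasible φ) where
  symm := by
    rintro Y Z ⟨_, T, rfl⟩
    rw [hφ.inner_normalMap hX, add_comm]
    exact ((real_inner_comm _ _).trans (hφ.inner_normalMap hX Z Y T)).symm
  level Y hY Z := by
    have hYZ : Z ∈ feasible φ ↔ gram Z (φ Z) = gram Y (φ Y) :=
      ⟨fun hZ => Subtype.ext (Eq.trans hZ (Eq.symm hY)),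
        fun hZ => (congrArg Subtype.val hZ).trans hY⟩
    rw [hYZ]
    refine ⟨?_, fun hZ => ext_inner_left ℝ fun T => ?_⟩
    · rintro hZ ⟨_, T, rfl⟩
      rw [hφ.inner_normalMap hX, hφ.inner_normalMap hX, hZ]
    · have h1 := hZ ⟨genSymLinear ψ T, T, rfl⟩
      rw [hφ.inner_normalMap hX, hφ.inner_normalMap hX, inner_add_right, inner_add_right] at h1
      linarith
  injective Y hY := by
    refine (injective_iff_map_eq_zero _).2 fun S hS => Subtype.ext (Subtype.ext ?_)
    -- Left multiplication by `Yᵀ` recovers `S` from `φ(Y) S`.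
    have h1 : (Y : Matrix (Fin n) (Fin p) ℝ)ᵀ * (φ Y : Matrix (Fin n) (Fin p) ℝ) = 1 := hY
    have h2 : (φ Y : Matrix (Fin n) (Fin p) ℝ) *
        ((S : gramSpan F) : Matrix (Fin p) (Fin p) ℝ) = 0 :=
      congrArg Subtype.val hS
    rw [← Matrix.one_mul ((S : gramSpan F) : Matrix (Fin p) (Fin p) ℝ), ← h1, Matrix.mul_assoc, h2,
      Matrix.mul_zero]
    rfl

theorem isLeastSquares_iff (hφ : Admissible hF φ ψ) (hX : X ∈ feasible φ) (D : F)
    (S : gramSpan F) : IsLeastSquares φ ψ X D S ↔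
      S = (normalCoeff (normalMap hF φ ψ) X D : gramSpan F) := by
  have key := (hφ.isQuadricIntersection hX).isMinOn_norm_sub_sq_iff hX D
  constructor
  · rintro ⟨hS, hmin⟩
    have h1 := (key ⟨S, hS⟩).1 fun S' _ => hmin S'.2
    exact congrArg Subtype.val h1
  · rintro rfl
    refine ⟨(normalCoeff (normalMap hF φ ψ) X D).2, fun S' hS' => ?_⟩
    have h1 := (key _).2 rfl
    exact @h1 ⟨S', hS'⟩ trivial

theorem leastSquaresSol_eq (hφ : Admissible hF φ ψ) (hX : X ∈ feasible φ) (D : F) :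
    leastSquaresSol φ ψ X D = (normalCoeff (normalMap hF φ ψ) X D : gramSpan F) :=
  (isLeastSquares_iff hφ hX D _).1
    (Classical.epsilon_spec ⟨_, (isLeastSquares_iff hφ hX D _).2 rfl⟩)

end GOOCP

end

open EmbeddedRiemannian GOOCP in
theorem mainTheorem6 {n p : ℕ} (hpn : p ≤ n) (F : Submodule ℝ (Matrix (Fin n) (Fin p) ℝ))
    (hF : ∀ X ∈ F, ∀ T ∈ gramSpan F, X * T ∈ F)
    (φ : F →ₗ[ℝ] F) (ψ : gramSpan F →ₗ[ℝ] gramSpan F) (hφ : Admissible hF φ ψ)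
    (f : F → ℝ) (hf : Differentiable ℝ f) (X : F) (hX : X ∈ feasible φ) :
    (∀ D : F, ∃! S, IsLeastSquares φ ψ X D S) ∧
    (riemannianGradient (feasible φ) f X : F) =
      ∇ f X - rightMul hF (φ X) (leastSquaresSol φ ψ X (∇ f X)) ∧
    IsRiemannianConnection (feasible φ) (riemannianConnection (feasible φ)) ∧
    (DifferentiableAt ℝ (∇ f) X →
      DifferentiableWithinAt ℝ (gradientField (feasible φ) f) (feasible φ) X ∧
      ∀ Z : tangentSpace (feasible φ) X,
        (riemannianHessian (feasible φ) f X Z : F) =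
          tangentProj (feasible φ) X (fderiv ℝ (∇ f) X Z -
            rightMul hF (φ Z) (leastSquaresSol φ ψ X (∇ f X)))) := by
  have h := hφ.isQuadricIntersection hX
  refine ⟨fun D => ⟨_, (isLeastSquares_iff hφ hX D _).2 rfl,
      fun S hS => (isLeastSquares_iff hφ hX D S).1 hS⟩, ?_,
    h.isRiemannianConnection_riemannianConnection, fun hf' => ⟨?_, fun Z => ?_⟩⟩
  · rw [riemannianGradient_eq_tangentProj (hf X), h.tangentProj_eq hX, leastSquaresSol_eq hφ hX]
    rfl
  · obtain ⟨A, hA⟩ := h.exists_hasFDerivWithinAt_gradientField hX hf hf'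
    exact hA.differentiableWithinAt
  · rw [h.riemannianHessian_apply hX hf hf', leastSquaresSol_eq hφ hX]
    rfl
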